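/- Let $K,N\ge 1$ be integers and let $0<M\le N$ be real. A server stores $N$ files of $F$ bits each and serves $K$ users over a shared error-free link. Placement: with allocation parameters $q_1,\dots,q_N\in[0,1]$, each user $k$ caches, independently over users and files, a uniformly random subset of $\lfloor q_iF\rfloor$ bits of file $i$. User $k$ then requests file $d_k$; the $d_k$ are i.i.d. with $\mathbb P(d_k=i)=p_i$, where $p_i\ge 0$, $\sum_i p_i=1$, and are independent of the placement. A bit is intended for user $k$ if it is a bit of file $d_k$ not cached by user $k$; it covers a set $\mathcal T$ of users if every user in $\mathcal T$ caches it. Set Centered Greedy Coded Delivery: visit all nonempty sets $\mathcal S\subseteq\{1,\dots,K\}$ in order of decreasing cardinality (sets of equal size in any fixed order). When $\mathcal S$ is visited, let $U_{k,\mathcal S\setminus\{k\}}$, for $k\in\mathcal S$, be the set of bits intended for user $k$ that have not yet been transmitted to user $k$ and that cover $\mathcal S\setminus\{k\}$; let $l_{\mathcal S}=\min_{k\in\mathcal S}|U_{k,\mathcal S\setminus\{k\}}|$, and let $W_{k,\mathcal S\setminus\{k\}}$ be the vector of the first $l_{\mathcal S}$ bits of $U_{k,\mathcal S\setminus\{k\}}$;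 if $l_{\mathcal S}>0$, the server sends the $l_{\mathcal S}$ bits $\bigoplus_{k\in\mathcal S}W_{k,\mathcal S\setminus\{k\}}$. The rate $R_{\boldsymbol d}$ is the total number of bits sent divided by $F$. Then, under even allocation $q_i=M/N$ for all $i$, for any file contents and as $F\to\infty$: for every fixed request vector $\boldsymbol d$, the rate $R_{\boldsymbol d}$ converges, in probability and in expectation over the placement, to $$\frac{1-M/N}{M/N}\left(1-\left(1-\frac MN\right)^K\right),$$ and the average rate $\mathbb E[R_{\boldsymbol d}]$ over placement and requests converges to the same value. -/

import Mathlib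

open Filter Topology

/-- The server stores `N` files of `F` bits each; `f i b` is the value of the `b`-th bit of file `i`. -/
abbrev Files (N F : ℕ) : Type := Fin N → Fin F → ZMod 2

/-- The contents of the caches of `K` users: `C k i` is the set of (positions of) bits of file `i`
cached by user `k`. -/
abbrev Caches (K N F : ℕ) : Type := Fin K → Fin N → Finset (Fin F)

namespace Caches

variable {K N F : ℕ}

/-- The bit `b` of file `i` covers the set `T` of users: every user in `T` caches it. -/
def Covers (C : Caches K N F) (i : Fin N) (b : Fin F) (T : Finset (Fin K)) : Prop :=
  ∀ j ∈ T, b ∈ C j i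

instance (C : Caches K N F) (i : Fin N) (b : Fin F) (T : Finset (Fin K)) :
    Decidable (C.Covers i b T) :=
  inferInstanceAs (Decidable (∀ j ∈ T, b ∈ C j i))

/-- Given the request vector `d`, the bits intended for user `k`: the bits of the requested file
`d k` that user `k` does not cache. -/
def intended (C : Caches K N F) (d : Fin K → Fin N) (k : Fin K) : Finset (Fin F) :=
  Finset.univ \ C k (d k)

end Caches

/-- Cache allocation placement with parameters `q`: the possible caches, in which every user stores
`⌊q i * F⌋` bits of file `i`. Every user chooses, independently for each file, a uniformly random
subset of that size, so the law of the placement is the uniform law on this (product) set. -/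
noncomputable def placements (K : ℕ) {N : ℕ} (q : Fin N → ℝ) (F : ℕ) : Finset (Caches K N F) :=
  Fintype.piFinset fun _ => Fintype.piFinset fun i =>
    Finset.powersetCard ⌊q i * (F : ℝ)⌋₊ Finset.univ

open Classical in
/-- Probability of the event `A` under the random placement. -/
noncomputable def placementProb (K : ℕ) {N : ℕ} (q : Fin N → ℝ) (F : ℕ)
    (A : Caches K N F → Prop) : ℝ :=
  (((placements K q F).filter A).card : ℝ) / ((placements K q F).card : ℝ)

/-- Expectation of the random variable `X` under the random placement. -/
noncomputable def placementExp (K : ℕ) {N : ℕ} (q : Fin N → ℝ) (F : ℕ)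
    (X : Caches K N F → ℝ) : ℝ :=
  (∑ C ∈ placements K q F, X C) / ((placements K q F).card : ℝ)

/-- An admissible order of visit for the two nested loops
`for s = K, K - 1, …, 1`, `for S ⊆ {users}, |S| = s`:
a list of all nonempty sets of users, each occurring once, with non-increasing cardinalities. -/
structure IsVisitingOrder {K : ℕ} (order : List (Finset (Fin K))) : Prop where
  nodup : order.Nodup
  mem_iff : ∀ S : Finset (Fin K), S ∈ order ↔ S.Nonempty
  decreasing : order.Pairwise fun S T => T.card ≤ S.card

namespace SGD

variable {K N F : ℕ}

/-- State of the delivery: for each user `k`, the bits intended for user `k` that have not been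
transmitted to `k` so far, and the list of the bits broadcast by the server so far. A bit of a file
requested by several users is delivered to each of these users separately. -/
structure State (K F : ℕ) where
  pending : Fin K → Finset (Fin F)
  sent : List (ZMod 2)

/-- The set `U_{k, S \ {k}}`: the bits intended for user `k`, not transmitted before, that cover
`S \ {k}`. -/
def U (C : Caches K N F) (d : Fin K → Fin N) (P : Fin K → Finset (Fin F))
    (S : Finset (Fin K)) (k : Fin K) : Finset (Fin F) :=
  (P k).filter fun b => C.Covers (d k) b (S.erase k)

/-- `l_S = min_{k ∈ S} |U_{k, S \ {k}}|` (the value at `S = ∅` is never used). -/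
def len (C : Caches K N F) (d : Fin K → Fin N) (P : Fin K → Finset (Fin F))
    (S : Finset (Fin K)) : ℕ :=
  if h : S.Nonempty then S.inf' h fun k => (U C d P S k).card else 0

/-- The vector `W_{k, S \ {k}}`: the first `l_S` bits of `U_{k, S \ {k}}`. -/
def W (C : Caches K N F) (d : Fin K → Fin N) (P : Fin K → Finset (Fin F))
    (S : Finset (Fin K)) (k : Fin K) : List (Fin F) :=
  ((U C d P S k).sort (· ≤ ·)).take (len C d P S)

/-- The signal `⊕_{k ∈ S} W_{k, S \ {k}}`, a bit vector of length `l_S` (empty if `l_S = 0`). For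
`k ∈ S` the list `W_{k, S \ {k}}` has length exactly `l_S`, so the default value `0` of `getD` does
not occur. -/
def signal (f : Files N F) (C : Caches K N F) (d : Fin K → Fin N) (P : Fin K → Finset (Fin F))
    (S : Finset (Fin K)) : List (ZMod 2) :=
  (List.range (len C d P S)).map fun t =>
    ∑ k ∈ S, ((W C d P S k).map (f (d k))).getD t 0

/-- One visit of the set `S`. -/
def visit (f : Files N F) (C : Caches K N F) (d : Fin K → Fin N) (st : State K F)
    (S : Finset (Fin K)) : State K F where
  pending k := if k ∈ S then st.pending k \ (W C d st.pending S k).toFinset else st.pending k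
  sent := st.sent ++ signal f C d st.pending S

/-- All bits broadcast by the set centered greedy coded delivery algorithm for the request `d`. -/
def broadcast (order : List (Finset (Fin K))) (f : Files N F) (C : Caches K N F)
    (d : Fin K → Fin N) : List (ZMod 2) :=
  (order.foldl (visit f C d) { pending := C.intended d, sent := [] }).sent

/-- The rate `R_d` of the algorithm: it broadcasts `R_d * F` bits. -/
noncomputable def rate (order : List (Finset (Fin K))) (f : Files N F) (C : Caches K N F)
    (d : Fin K → Fin N) : ℝ :=
  ((broadcast order f C d).length : ℝ) / (F : ℝ)

/-- The average rate `E[R]`: the mean over the random placement and over the request vector `d`,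
whose entries are independent with `P(d_k = i) = p i`, independently of the placement. -/
noncomputable def averageRate (order : List (Finset (Fin K))) (q p : Fin N → ℝ)
    (f : Files N F) : ℝ :=
  ∑ d : Fin K → Fin N, (∏ k, p (d k)) * placementExp K q F fun C => rate order f C d

end SGD

/-! Sort the bits of each file by the exact set of users caching them. A bit of file `d k` cached by
exactly the users in `S \ {k}` is still pending for `k` when `S` is visited: a bit sent to `k` at a
set `S'` covers `S' \ {k}`, which forces `S' ⊆ S`, while every set visited earlier is different from
`S` and at least as large. With `x = M / N`, each such class has about `v S = F x^(|S|-1)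
(1-x)^(K-|S|+1)` bits, whatever the file, so the visit of `S` sends at least about `v S` bits. By
the binomial theorem, the sum of `v S` over nonempty `S` is `F` times the claimed limit.

Unmatched bits spill over to smaller sets, so the upper bound comes from conservation: a visit
removes exactly `l_S` bits from the pending set of each member of `S`, and user `k` starts with
about `∑_{S ∋ k} v S` bits. Any excess over the `v S` is therefore paid for by a small per-user
discrepancy (`length_sent_foldl_visit`). The result, `abs_length_broadcast_sub_le`, holds for every
placement, with error a constant depending on `K` times `deviation`.

Randomness enters only through `deviation`. Exact second moments of the class sizes show that two
bits become asymptotically independent, so the class frequencies converge in L², hence in L¹. L¹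
convergence of the rate gives all three conclusions. -/

namespace Caches

variable {K N F : ℕ}

/-- The bits of file `i` that are cached by the users in `T` and by no other user. -/
def exactBits (C : Caches K N F) (i : Fin N) (T : Finset (Fin K)) : Finset (Fin F) :=
  Finset.univ.filter fun b => ∀ j, b ∈ C j i ↔ j ∈ T

theorem mem_exactBits {C : Caches K N F} {i : Fin N} {T : Finset (Fin K)} {b : Fin F} :
    b ∈ C.exactBits i T ↔ ∀ j, b ∈ C j i ↔ j ∈ T := by
  simp [exactBits]

theorem exactBits_erase_subset_intended (C : Caches K N F) (d : Fin K → Fin N) (k : Fin K)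
    (S : Finset (Fin K)) : C.exactBits (d k) (S.erase k) ⊆ C.intended d k := by
  intro b hb
  have := (mem_exactBits.1 hb) k
  simp_all [intended]

/-- The bits intended for user `k` are partitioned according to the set of users caching them. -/
theorem card_intended (C : Caches K N F) (d : Fin K → Fin N) (k : Fin K) :
    (C.intended d k).card =
      ∑ S ∈ Finset.univ.filter (fun S : Finset (Fin K) => k ∈ S),
        (C.exactBits (d k) (S.erase k)).card := by
  rw [Finset.card_eq_sum_card_fiberwise
    (f := fun b => insert k (Finset.univ.filter fun j => b ∈ C j (d k)))
    (t := Finset.univ.filter (fun S : Finset (Fin K) => k ∈ S)) (fun b _ => by simp)]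
  refine Finset.sum_congr rfl fun S hS => congrArg Finset.card ?_
  have hk : k ∈ S := by simpa using hS
  ext b
  simp only [Finset.mem_filter, intended, Finset.mem_sdiff, Finset.mem_univ, true_and,
    mem_exactBits, Finset.ext_iff, Finset.mem_insert, Finset.mem_erase]
  constructor
  · rintro ⟨h1, h2⟩ j
    have := h2 j
    by_cases hj : j = k
    · subst hj; simp [h1]
    · simp_all
  · intro h
    refine ⟨by simpa using h k, fun j => ?_⟩
    have := h j
    by_cases hj : j = k
    · subst hj; simp [hk]
    · simp_all

end Caches

/-! ### Delivery: persistence of exact classes and conservation of pending bits -/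

namespace SGD

variable {K N F : ℕ}

theorem len_le_card_U (C : Caches K N F) (d : Fin K → Fin N) (P : Fin K → Finset (Fin F))
    {S : Finset (Fin K)} {k : Fin K} (hk : k ∈ S) : len C d P S ≤ (U C d P S k).card := by
  rw [len, dif_pos ⟨k, hk⟩]
  exact Finset.inf'_le (f := fun k => (U C d P S k).card) hk

theorem W_toFinset_subset_U (C : Caches K N F) (d : Fin K → Fin N) (P : Fin K → Finset (Fin F))
    (S : Finset (Fin K)) (k : Fin K) : (W C d P S k).toFinset ⊆ U C d P S k := by
  intro b hb
  rw [List.mem_toFinset] at hb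
  simpa using List.mem_of_mem_take hb

theorem card_W_toFinset (C : Caches K N F) (d : Fin K → Fin N) (P : Fin K → Finset (Fin F))
    {S : Finset (Fin K)} {k : Fin K} (hk : k ∈ S) :
    (W C d P S k).toFinset.card = len C d P S := by
  have hnd : (W C d P S k).Nodup :=
    (Finset.sort_nodup (U C d P S k) (· ≤ ·)).sublist (List.take_sublist _ _)
  rw [List.toFinset_card_of_nodup hnd, W, List.length_take, Finset.length_sort]
  exact min_eq_left (len_le_card_U C d P hk)

theorem length_sent_visit (f : Files N F) (C : Caches K N F) (d : Fin K → Fin N)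
    (st : State K F) (S : Finset (Fin K)) :
    (visit f C d st S).sent.length = st.sent.length + len C d st.pending S := by
  simp [visit, signal]

/-- Conservation law behind the upper bound: the `l_S` entries of `W` are distinct and all pending.
-/
theorem card_pending_visit (f : Files N F) (C : Caches K N F) (d : Fin K → Fin N)
    (st : State K F) (S : Finset (Fin K)) (k : Fin K) :
    ((visit f C d st S).pending k).card + (if k ∈ S then len C d st.pending S else 0) =
      (st.pending k).card := by
  by_cases hk : k ∈ S
  · have hsub : (W C d st.pending S k).toFinset ⊆ st.pending k :=
      (W_toFinset_subset_U C d st.pending S k).trans (Finset.filter_subset _ _)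
    have := Finset.card_sdiff_add_card_eq_card hsub
    rw [card_W_toFinset C d st.pending hk] at this
    simpa [visit, hk] using this
  · simp [visit, hk]

/-- Visiting a set `S` does not affect the bits that are cached exactly by the other members of a
set `T ≠ S` that is not larger than `S`. -/
theorem exactBits_subset_pending_visit {f : Files N F} {C : Caches K N F} {d : Fin K → Fin N}
    {st : State K F} {S T : Finset (Fin K)} {k : Fin K} (hk : k ∈ T) (hne : S ≠ T)
    (hcard : T.card ≤ S.card) (h : C.exactBits (d k) (T.erase k) ⊆ st.pending k) :
    C.exactBits (d k) (T.erase k) ⊆ (visit f C d st S).pending k := by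
  by_cases hkS : k ∈ S
  · intro b hb
    simp only [visit, hkS, if_true, Finset.mem_sdiff]
    refine ⟨h hb, fun hW => hne ?_⟩
    have hcov := (Finset.mem_filter.1 (W_toFinset_subset_U C d st.pending S k hW)).2
    -- A bit sent at `S` covers `S.erase k`, but its only cachers are `T.erase k`; so `S ⊆ T`, and
    -- the cardinalities force equality.
    refine Finset.eq_of_subset_of_card_le (fun j hj => ?_) hcard
    by_cases hjk : j = k
    · exact hjk ▸ hk
    · exact Finset.mem_of_mem_erase
        ((Caches.mem_exactBits.1 hb j).1 (hcov j (Finset.mem_erase.2 ⟨hjk, hj⟩)))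
  · simpa [visit, hkS] using h

theorem le_len_of_exactBits_subset {C : Caches K N F} {d : Fin K → Fin N}
    {P : Fin K → Finset (Fin F)} {S : Finset (Fin K)} (hS : S.Nonempty) {w : ℝ}
    (hP : ∀ k ∈ S, C.exactBits (d k) (S.erase k) ⊆ P k)
    (hw : ∀ k ∈ S, w ≤ (C.exactBits (d k) (S.erase k)).card) : w ≤ len C d P S := by
  rw [len, dif_pos hS]
  obtain ⟨k, hk, hmin⟩ := Finset.exists_mem_eq_inf' hS fun k => (U C d P S k).card
  rw [hmin]
  refine (hw k hk).trans (Nat.cast_le.2 (Finset.card_le_card fun b hb => ?_))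
  exact Finset.mem_filter.2 ⟨hP k hk hb, fun j hj => (Caches.mem_exactBits.1 hb j).2 hj⟩

/-- Bounds on the number of bits sent while visiting the sets of a list, in terms of lower bounds
`w S` on the numbers of bits cached exactly by the other members of `S`. -/
theorem length_sent_foldl_visit (f : Files N F) (C : Caches K N F) (d : Fin K → Fin N)
    (w : Finset (Fin K) → ℝ) (l : List (Finset (Fin K))) (hnd : l.Nodup)
    (hl : l.Pairwise fun S T => T.card ≤ S.card) (hne : ∀ S ∈ l, S.Nonempty)
    (hw : ∀ S ∈ l, ∀ k ∈ S, w S ≤ (C.exactBits (d k) (S.erase k)).card)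
    (st : State K F) (hst : ∀ S ∈ l, ∀ k ∈ S, C.exactBits (d k) (S.erase k) ⊆ st.pending k) :
    (l.map w).sum ≤ ((l.foldl (visit f C d) st).sent.length : ℝ) - st.sent.length ∧
    ((l.foldl (visit f C d) st).sent.length : ℝ) - st.sent.length - (l.map w).sum ≤
      ∑ k, (((st.pending k).card : ℝ) - ((l.foldl (visit f C d) st).pending k).card
        - (l.map fun S => if k ∈ S then w S else 0).sum) := by
  induction l generalizing st with
  | nil => simp
  | cons S l ih =>
    rw [List.nodup_cons] at hnd
    rw [List.pairwise_cons] at hl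
    simp only [List.forall_mem_cons] at hne hw hst
    obtain ⟨h1, h2⟩ := ih hnd.2 hl.2 hne.2 hw.2 (visit f C d st S) fun T hT k hk =>
      exactBits_subset_pending_visit hk (fun h => hnd.1 (h ▸ hT)) (hl.1 T hT) (hst.2 T hT k hk)
    have hlen : w S ≤ len C d st.pending S := le_len_of_exactBits_subset hne.1 hst.1 hw.1
    simp only [length_sent_visit, Nat.cast_add] at h1 h2
    simp only [List.foldl_cons, List.map_cons, List.sum_cons]
    refine ⟨by linarith, ?_⟩
    -- The excess `len - w S` is nonnegative and `S` has a member, so charging it to every member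
    -- only overcounts.
    have hstep : (len C d st.pending S : ℝ) - w S ≤
        ∑ k, if k ∈ S then (len C d st.pending S : ℝ) - w S else 0 := by
      obtain ⟨k, hk⟩ := hne.1
      have := Finset.single_le_sum
        (f := fun k => if k ∈ S then (len C d st.pending S : ℝ) - w S else 0)
        (fun k _ => by split_ifs <;> linarith) (Finset.mem_univ k)
      simpa [hk] using this
    refine (show _ ≤ _ from by linarith : _ ≤ (∑ k, if k ∈ S then
      (len C d st.pending S : ℝ) - w S else 0) + _).trans ((add_le_add_right h2 _).trans ?_)
    rw [← Finset.sum_add_distrib]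
    refine le_of_eq (Finset.sum_congr rfl fun k _ => ?_)
    have := congrArg (Nat.cast : ℕ → ℝ) (card_pending_visit f C d st S k)
    rw [Nat.cast_add] at this
    rw [← this]
    split_ifs <;> push_cast <;> ring

end SGD

/-! ### Deterministic error bound in terms of the deviation -/

/-- Total deviation of the numbers of bits cached exactly by given sets of users from the values
expected when every user caches each bit independently with probability `x`. -/
noncomputable def Caches.deviation {K N F : ℕ} (C : Caches K N F) (x : ℝ) : ℝ :=
  ∑ i, ∑ T : Finset (Fin K),
    |((C.exactBits i T).card : ℝ) - F * (x ^ T.card * (1 - x) ^ (K - T.card))|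

theorem Caches.abs_card_exactBits_sub_le {K N F : ℕ} (C : Caches K N F) (x : ℝ) (i : Fin N)
    (T : Finset (Fin K)) :
    |((C.exactBits i T).card : ℝ) - F * (x ^ T.card * (1 - x) ^ (K - T.card))| ≤
      C.deviation x := by
  refine le_trans ?_ (Finset.single_le_sum (f := fun i => ∑ T : Finset (Fin K),
    |((C.exactBits i T).card : ℝ) - F * (x ^ T.card * (1 - x) ^ (K - T.card))|)
    (fun i _ => Finset.sum_nonneg fun T _ => abs_nonneg _) (Finset.mem_univ i))
  exact Finset.single_le_sum (f := fun T : Finset (Fin K) =>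
    |((C.exactBits i T).card : ℝ) - F * (x ^ T.card * (1 - x) ^ (K - T.card))|)
    (fun T _ => abs_nonneg _) (Finset.mem_univ T)

/-- Lowering the exponent `|S|` by one pulls out the factor `(1 - x) / x`; what remains is the
binomial expansion of `(x + (1 - x))^K` without its empty-set term. -/
theorem sum_nonempty_pow_mul_pow (K : ℕ) {x : ℝ} (hx : x ≠ 0) :
    ∑ S ∈ Finset.univ.filter (fun S : Finset (Fin K) => S.Nonempty),
      x ^ (S.card - 1) * (1 - x) ^ (K - (S.card - 1)) =
      (1 - x) / x * (1 - (1 - x) ^ K) := by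
  have hterm : ∀ S ∈ Finset.univ.filter (fun S : Finset (Fin K) => S.Nonempty),
      x ^ (S.card - 1) * (1 - x) ^ (K - (S.card - 1)) =
        (1 - x) / x * (x ^ S.card * (1 - x) ^ (K - S.card)) := by
    intro S hS
    have hpos : 0 < S.card := Finset.card_pos.2 (Finset.mem_filter.1 hS).2
    have hle : S.card ≤ K := by simpa using Finset.card_le_univ S
    obtain ⟨n, hn⟩ := Nat.exists_eq_add_of_lt hpos
    rw [hn, show K - (0 + n + 1 - 1) = K - (0 + n + 1) + 1 by omega, pow_succ]
    simp only [Nat.zero_add, Nat.add_sub_cancel, pow_succ]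
    field_simp
  rw [Finset.sum_congr rfl hterm, ← Finset.mul_sum]
  congr 1
  have hall : ∑ S : Finset (Fin K), x ^ S.card * (1 - x) ^ (K - S.card) = 1 := by
    have := Fintype.sum_pow_mul_eq_add_pow (Fin K) x (1 - x)
    simpa using this
  rw [← Finset.sum_filter_add_sum_filter_not Finset.univ
    (fun S : Finset (Fin K) => S.Nonempty)] at hall
  have hempty : Finset.univ.filter (fun S : Finset (Fin K) => ¬ S.Nonempty) = {∅} := by
    ext S; simp
  rw [hempty] at hall
  simp only [Finset.sum_singleton, Finset.card_empty, pow_zero, one_mul, Nat.sub_zero] at hall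
  linarith

namespace SGD

variable {K N F : ℕ}

/-- The rate is close to its limit for every placement of small deviation. -/
theorem abs_length_broadcast_sub_le {order : List (Finset (Fin K))}
    (horder : IsVisitingOrder order) (f : Files N F) (C : Caches K N F) (d : Fin K → Fin N)
    {x : ℝ} (hx : x ≠ 0) :
    |((broadcast order f C d).length : ℝ) - F * ((1 - x) / x * (1 - (1 - x) ^ K))| ≤
      (2 * K + 1) * 2 ^ K * C.deviation x := by
  set δ := C.deviation x with hδ
  have hδ0 : 0 ≤ δ := Finset.sum_nonneg fun i _ => Finset.sum_nonneg fun T _ => abs_nonneg _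
  set v : Finset (Fin K) → ℝ := fun S =>
    F * (x ^ (S.card - 1) * (1 - x) ^ (K - (S.card - 1))) with hv
  have hdev : ∀ S : Finset (Fin K), ∀ k ∈ S,
      |((C.exactBits (d k) (S.erase k)).card : ℝ) - v S| ≤ δ := by
    intro S k hk
    have := C.abs_card_exactBits_sub_le x (d k) (S.erase k)
    rwa [Finset.card_erase_of_mem hk] at this
  set A := Finset.univ.filter (fun S : Finset (Fin K) => S.Nonempty) with hA
  have hfin : order.toFinset = A := by
    ext S; simp [horder.mem_iff, hA]
  have hsum : ∀ g : Finset (Fin K) → ℝ, (order.map g).sum = ∑ S ∈ A, g S := by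
    intro g
    rw [← hfin, List.sum_toFinset _ horder.nodup]
  have hvsum : ∑ S ∈ A, v S = F * ((1 - x) / x * (1 - (1 - x) ^ K)) := by
    rw [← sum_nonempty_pow_mul_pow K hx, Finset.mul_sum]
  have hAcard : (A.card : ℝ) ≤ 2 ^ K := by
    have : A.card ≤ 2 ^ K := by
      simpa using Finset.card_le_univ A
    exact_mod_cast this
  -- Subtracting `δ` from `v S` gives a lower bound on the class sizes valid for all members of `S`
  -- at once.
  obtain ⟨hlow, hupp⟩ := length_sent_foldl_visit f C d (fun S => v S - δ) order horder.nodup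
    horder.decreasing (fun S hS => (horder.mem_iff S).1 hS)
    (fun S _ k hk => by have := abs_le.1 (hdev S k hk); linarith)
    { pending := C.intended d, sent := [] }
    (fun S _ k _ => C.exactBits_erase_subset_intended d k S)
  change _ ≤ ((broadcast order f C d).length : ℝ) - _ at hlow
  change ((broadcast order f C d).length : ℝ) - _ - _ ≤ _ at hupp
  rw [hsum, Finset.sum_sub_distrib, hvsum, Finset.sum_const, nsmul_eq_mul] at hlow hupp
  simp only [List.length_nil, Nat.cast_zero, sub_zero] at hlow hupp
  have huser : ∀ k : Fin K, ((C.intended d k).card : ℝ)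
      - ((order.foldl (visit f C d)
          { pending := C.intended d, sent := [] }).pending k).card
      - (order.map fun S => if k ∈ S then v S - δ else 0).sum ≤ 2 ^ K * (2 * δ) := by
    intro k
    rw [hsum, ← Finset.sum_filter]
    have hAk : A.filter (fun S => k ∈ S) =
        Finset.univ.filter (fun S : Finset (Fin K) => k ∈ S) := by
      ext S
      simp only [hA, Finset.mem_filter, Finset.mem_univ, true_and, and_iff_right_iff_imp]
      exact fun h => ⟨k, h⟩
    rw [hAk, C.card_intended d k, Nat.cast_sum]
    -- Each class size is at most `v S + δ`, which exceeds the lower bound `v S - δ` by `2 * δ`.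
    have hle : ∑ S ∈ Finset.univ.filter (fun S : Finset (Fin K) => k ∈ S),
        (((C.exactBits (d k) (S.erase k)).card : ℝ) - (v S - δ)) ≤ 2 ^ K * (2 * δ) := by
      refine (Finset.sum_le_card_nsmul _ _ (2 * δ) fun S hS => ?_).trans ?_
      · have := abs_le.1 (hdev S k (Finset.mem_filter.1 hS).2)
        linarith
      · rw [nsmul_eq_mul]
        refine mul_le_mul_of_nonneg_right ?_ (by linarith)
        have : (Finset.univ.filter (fun S : Finset (Fin K) => k ∈ S)).card ≤ 2 ^ K := by
          simpa using Finset.card_le_univ (Finset.univ.filter (fun S : Finset (Fin K) => k ∈ S))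
        exact_mod_cast this
    rw [Finset.sum_sub_distrib] at hle
    have : (0 : ℝ) ≤ ((order.foldl (visit f C d)
          { pending := C.intended d, sent := [] }).pending k).card := Nat.cast_nonneg _
    linarith
  have hall := Finset.sum_le_card_nsmul Finset.univ _ _ fun k _ => huser k
  rw [Finset.card_univ, Fintype.card_fin, nsmul_eq_mul] at hall
  have hAδ : (A.card : ℝ) * δ ≤ 2 ^ K * δ := mul_le_mul_of_nonneg_right hAcard hδ0
  have hKδ : (0 : ℝ) ≤ K * (2 ^ K * (2 * δ)) := by positivity
  have hAδ0 : (0 : ℝ) ≤ A.card * δ := by positivity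
  have h2δ : (0 : ℝ) ≤ 2 ^ K * δ := by positivity
  -- The lower error is at most `2^K * δ` and the upper one at most `2 * K * 2^K * δ`; the constant
  -- is the sum of both.
  rw [abs_le]
  constructor
  · linarith
  · linarith

theorem abs_rate_sub_le {order : List (Finset (Fin K))}
    (horder : IsVisitingOrder order) (f : Files N F) (C : Caches K N F) (d : Fin K → Fin N)
    {x : ℝ} (hx : x ≠ 0) (hF : 0 < F) :
    |rate order f C d - (1 - x) / x * (1 - (1 - x) ^ K)| ≤
      (2 * K + 1) * 2 ^ K * (C.deviation x / F) := by
  have hF' : (0 : ℝ) < F := Nat.cast_pos.2 hF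
  have h := abs_length_broadcast_sub_le horder f C d hx
  have heq : rate order f C d - (1 - x) / x * (1 - (1 - x) ^ K) =
      (((broadcast order f C d).length : ℝ) - F * ((1 - x) / x * (1 - (1 - x) ^ K))) / F := by
    rw [eq_div_iff hF'.ne', sub_mul, rate, div_mul_cancel₀ _ hF'.ne', mul_comm (F : ℝ)]
  rw [heq, abs_div, abs_of_pos hF', ← mul_div_assoc]
  exact div_le_div_of_nonneg_right h hF'.le

end SGD

/-! ### One and two bits in a uniformly random subset -/

/-- Mean of `g` over the subsets of `Fin F` with `m` elements. -/
noncomputable def subsetMean (F m : ℕ) (g : Finset (Fin F) → ℝ) : ℝ :=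
  (∑ A ∈ Finset.powersetCard m (Finset.univ : Finset (Fin F)), g A) / (F.choose m : ℝ)

section SubsetMean

variable {F m : ℕ}

theorem subsetMean_one (hm : m ≤ F) : subsetMean F m (fun _ => 1) = 1 := by
  have : (F.choose m : ℝ) ≠ 0 := Nat.cast_ne_zero.2 (Nat.choose_pos hm).ne'
  simp [subsetMean, this]

theorem subsetMean_disjoint (B : Finset (Fin F)) :
    subsetMean F m (fun A => if Disjoint B A then 1 else 0) =
      ((F - B.card).choose m : ℝ) / F.choose m := by
  rw [subsetMean, Finset.sum_boole]
  congr 2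
  have hB : (Finset.univ \ B).card = F - B.card := by
    rw [Finset.card_sdiff_of_subset (Finset.subset_univ B), Finset.card_univ, Fintype.card_fin]
  rw [← hB, ← Finset.card_powersetCard]
  congr 1
  ext A
  simp only [Finset.mem_filter, Finset.mem_powersetCard, Finset.subset_univ, true_and,
    Finset.subset_sdiff, disjoint_comm (a := B)]
  tauto

theorem cast_choose_pred_mul {n k : ℕ} (hn : 0 < n) (hk : k ≤ n) :
    ((n - 1).choose k : ℝ) * n = n.choose k * (n - k) := by
  obtain ⟨n, rfl⟩ := Nat.exists_eq_succ_of_ne_zero hn.ne'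
  have := congrArg (Nat.cast : ℕ → ℝ) (Nat.choose_mul_succ_eq n k)
  rw [Nat.cast_mul, Nat.cast_mul, Nat.cast_sub hk] at this
  simpa using this

theorem subsetMean_notMem (hm : m ≤ F) (b : Fin F) :
    subsetMean F m (fun A => if b ∈ A then 0 else 1) = 1 - m / F := by
  have hF : 0 < F := b.pos
  have h := subsetMean_disjoint (m := m) {b}
  have hc : (F.choose m : ℝ) ≠ 0 := Nat.cast_ne_zero.2 (Nat.choose_pos hm).ne'
  have hF' : (F : ℝ) ≠ 0 := Nat.cast_ne_zero.2 hF.ne'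
  simp only [Finset.disjoint_singleton_left, ite_not, Finset.card_singleton] at h
  rw [h, div_eq_iff hc, ← mul_left_inj' hF', cast_choose_pred_mul hF hm]
  field_simp

/-- Probability that a random set of `m` elements of `Fin F` avoids two given elements. -/
noncomputable def avoidPair (F m : ℕ) : ℝ :=
  (1 - m / F) * ((1 - m / F - 1 / F) / (1 - 1 / F))

theorem subsetMean_notMem_pair (hm : m ≤ F) {b c : Fin F} (hbc : b ≠ c) :
    subsetMean F m (fun A => if b ∈ A then 0 else if c ∈ A then 0 else 1) = avoidPair F m := by
  have hF : 2 ≤ F := by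
    by_contra h
    exact hbc (Fin.ext (by omega))
  have h := subsetMean_disjoint (m := m) {b, c}
  have hc : (F.choose m : ℝ) ≠ 0 := Nat.cast_ne_zero.2 (Nat.choose_pos hm).ne'
  have hF' : (F : ℝ) ≠ 0 := Nat.cast_ne_zero.2 (by omega)
  have hF1 : (F : ℝ) - 1 ≠ 0 := by
    have : (2 : ℝ) ≤ F := by exact_mod_cast hF
    linarith
  have heq : (fun A : Finset (Fin F) => if b ∈ A then (0 : ℝ) else if c ∈ A then 0 else 1) =
      fun A => if Disjoint {b, c} A then 1 else 0 := by
    funext A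
    simp only [Finset.disjoint_insert_left, Finset.disjoint_singleton_left]
    split_ifs <;> simp_all
  rw [Finset.card_pair hbc] at h
  have h1 := cast_choose_pred_mul (n := F) (by omega) hm
  -- When `m = F` the real factor `F - 1 - m` is negative, but both binomial coefficients vanish.
  have h2 : ((F - 2).choose m : ℝ) * (F - 1) = (F - 1).choose m * (F - 1 - m) := by
    rcases Nat.lt_or_ge (F - 1) m with hlt | hge
    · rw [Nat.choose_eq_zero_of_lt hlt, Nat.choose_eq_zero_of_lt (by omega)]
      simp
    · have := cast_choose_pred_mul (n := F - 1) (by omega) hge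
      rw [Nat.cast_sub (by omega : 1 ≤ F), Nat.cast_one] at this
      exact this
  have h3 : ((F - 2).choose m : ℝ) * ((F - 1) * F) = F.choose m * ((F - m) * (F - 1 - m)) := by
    linear_combination (F : ℝ) * h2 + ((F : ℝ) - 1 - m) * h1
  rw [heq, h, div_eq_iff hc, ← mul_left_inj' (mul_ne_zero hF1 hF'), h3, avoidPair]
  have : (1 : ℝ) - 1 / F ≠ 0 := by
    rw [sub_ne_zero]; intro h; apply hF1; field_simp at h; linarith
  have hA : (1 : ℝ) - 1 / F = (F - 1) / F := by field_simp
  rw [hA]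
  field_simp
  ring

/-- Indicator that membership of `b` in `A` is as prescribed by `P`. -/
def memIndicator (P : Prop) [Decidable P] (b : Fin F) (A : Finset (Fin F)) : ℝ :=
  if b ∈ A ↔ P then 1 else 0

theorem subsetMean_sub (g h : Finset (Fin F) → ℝ) :
    subsetMean F m (fun A => g A - h A) = subsetMean F m g - subsetMean F m h := by
  simp [subsetMean, sub_div]

theorem subsetMean_add (g h : Finset (Fin F) → ℝ) :
    subsetMean F m (fun A => g A + h A) = subsetMean F m g + subsetMean F m h := by
  simp [subsetMean, Finset.sum_add_distrib, add_div]

theorem subsetMean_memIndicator (hm : m ≤ F) (P : Prop) [Decidable P] (b : Fin F) :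
    subsetMean F m (memIndicator P b) = if P then (m : ℝ) / F else 1 - m / F := by
  by_cases hP : P
  · have : memIndicator P b = fun A => 1 - if b ∈ A then (0 : ℝ) else 1 := by
      funext A
      simp only [memIndicator, hP, iff_true]
      split_ifs <;> simp
    rw [this, subsetMean_sub, subsetMean_one hm, subsetMean_notMem hm, if_pos hP]
    ring
  · have : memIndicator P b = fun A => if b ∈ A then (0 : ℝ) else 1 := by
      funext A
      simp only [memIndicator, hP, iff_false]
      split_ifs <;> simp_all
    rw [this, subsetMean_notMem hm, if_neg hP]

/-- Inclusion–exclusion reduces joint presence of two elements to avoidance probabilities. -/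
theorem subsetMean_memIndicator_mul (hm : m ≤ F) (P : Prop) [Decidable P] {b c : Fin F}
    (hbc : b ≠ c) :
    subsetMean F m (fun A => memIndicator P b A * memIndicator P c A) =
      if P then 1 - 2 * (1 - (m : ℝ) / F) + avoidPair F m else avoidPair F m := by
  by_cases hP : P
  · have : (fun A => memIndicator P b A * memIndicator P c A) = fun A =>
        ((1 - if b ∈ A then (0 : ℝ) else 1) - if c ∈ A then (0 : ℝ) else 1) +
          if b ∈ A then 0 else if c ∈ A then 0 else 1 := by
      funext A
      simp only [memIndicator, hP, iff_true]
      split_ifs <;> simp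
    rw [this, subsetMean_add, subsetMean_sub, subsetMean_sub, subsetMean_one hm,
      subsetMean_notMem hm, subsetMean_notMem hm, subsetMean_notMem_pair hm hbc, if_pos hP]
    ring
  · have : (fun A => memIndicator P b A * memIndicator P c A) = fun A =>
        if b ∈ A then (0 : ℝ) else if c ∈ A then 0 else 1 := by
      funext A
      simp only [memIndicator, hP, iff_false]
      split_ifs <;> simp_all
    rw [this, subsetMean_notMem_pair hm hbc, if_neg hP]

end SubsetMean

/-! ### Expectation over placements and moments of the class sizes -/

section Placement

variable {K N F : ℕ} {q : Fin N → ℝ}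

theorem card_placements (K : ℕ) (q : Fin N → ℝ) (F : ℕ) :
    (placements K q F).card = (∏ i, F.choose ⌊q i * (F : ℝ)⌋₊) ^ K := by
  simp [placements]

theorem placements_card_pos (hq : ∀ i, q i ≤ 1) : 0 < (placements K q F).card := by
  rw [card_placements]
  refine pow_pos (Finset.prod_pos fun i _ => Nat.choose_pos (Nat.floor_le_of_le ?_)) K
  exact mul_le_of_le_one_left (Nat.cast_nonneg F) (hq i)

theorem placementExp_const (hq : ∀ i, q i ≤ 1) (a : ℝ) :
    placementExp K q F (fun _ => a) = a := by
  have : ((placements K q F).card : ℝ) ≠ 0 := Nat.cast_ne_zero.2 (placements_card_pos hq).ne'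
  rw [placementExp, Finset.sum_const, nsmul_eq_mul, mul_div_cancel_left₀ _ this]

theorem placementExp_add (X Y : Caches K N F → ℝ) :
    placementExp K q F (fun C => X C + Y C) = placementExp K q F X + placementExp K q F Y := by
  simp [placementExp, Finset.sum_add_distrib, add_div]

theorem placementExp_sub (X Y : Caches K N F → ℝ) :
    placementExp K q F (fun C => X C - Y C) = placementExp K q F X - placementExp K q F Y := by
  simp [placementExp, sub_div]

theorem placementExp_const_mul (a : ℝ) (X : Caches K N F → ℝ) :
    placementExp K q F (fun C => a * X C) = a * placementExp K q F X := by
  simp [placementExp, ← Finset.mul_sum, mul_div_assoc]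

theorem placementExp_sum {ι : Type*} (s : Finset ι) (X : ι → Caches K N F → ℝ) :
    placementExp K q F (fun C => ∑ a ∈ s, X a C) = ∑ a ∈ s, placementExp K q F (X a) := by
  simp only [placementExp]
  rw [Finset.sum_comm, Finset.sum_div]

theorem placementExp_mono {X Y : Caches K N F → ℝ} (h : ∀ C, X C ≤ Y C) :
    placementExp K q F X ≤ placementExp K q F Y :=
  div_le_div_of_nonneg_right (Finset.sum_le_sum fun C _ => h C) (Nat.cast_nonneg _)

theorem abs_placementExp_le (X : Caches K N F → ℝ) :
    |placementExp K q F X| ≤ placementExp K q F fun C => |X C| := by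
  rw [placementExp, abs_div, Nat.abs_cast]
  exact div_le_div_of_nonneg_right (Finset.abs_sum_le_sum_abs _ _) (Nat.cast_nonneg _)

theorem placementExp_sq_le (X : Caches K N F → ℝ) :
    placementExp K q F X ^ 2 ≤ placementExp K q F fun C => X C ^ 2 := by
  rcases Nat.eq_zero_or_pos (placements K q F).card with h | h
  · simp [placementExp, h]
  · have h' : (0 : ℝ) < (placements K q F).card := Nat.cast_pos.2 h
    rw [placementExp, placementExp, div_pow, div_le_div_iff₀ (by positivity) h']
    have := sq_sum_le_card_mul_sum_sq (s := placements K q F) (f := X)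
    nlinarith

/-- Markov's inequality. -/
theorem placementProb_le {X : Caches K N F → ℝ} (hX : ∀ C, 0 ≤ X C) {ε : ℝ} (hε : 0 < ε) :
    placementProb K q F (fun C => ε ≤ X C) ≤ placementExp K q F X / ε := by
  classical
  rw [le_div_iff₀ hε, placementProb, placementExp, div_mul_eq_mul_div]
  refine div_le_div_of_nonneg_right ?_ (Nat.cast_nonneg _)
  rw [← nsmul_eq_mul]
  refine (Finset.card_nsmul_le_sum _ X ε fun C hC => (Finset.mem_filter.1 hC).2).trans ?_
  exact Finset.sum_le_sum_of_subset_of_nonneg (Finset.filter_subset _ _) fun C _ _ => hX C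

theorem placementProb_nonneg (A : Caches K N F → Prop) : 0 ≤ placementProb K q F A := by
  unfold placementProb
  positivity

/-- The cached parts of file `i` are independent over the users, and uniformly distributed. -/
theorem placementExp_prod (hq : ∀ i, q i ≤ 1) (i : Fin N) (g : Fin K → Finset (Fin F) → ℝ) :
    placementExp K q F (fun C => ∏ j, g j (C j i)) =
      ∏ j, subsetMean F ⌊q i * (F : ℝ)⌋₊ (g j) := by
  -- For a single user, the files other than `i` contribute only the number of their possible cached
  -- parts.
  have hone : ∀ h : Finset (Fin F) → ℝ,
      ∑ c ∈ Fintype.piFinset (fun i => Finset.powersetCard ⌊q i * (F : ℝ)⌋₊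
        (Finset.univ : Finset (Fin F))), h (c i) =
      (∏ i, (F.choose ⌊q i * (F : ℝ)⌋₊ : ℝ)) * subsetMean F ⌊q i * (F : ℝ)⌋₊ h := by
    intro h
    have hch : (F.choose ⌊q i * (F : ℝ)⌋₊ : ℝ) ≠ 0 :=
      Nat.cast_ne_zero.2 (Nat.choose_pos (Nat.floor_le_of_le
        (mul_le_of_le_one_left (Nat.cast_nonneg F) (hq i)))).ne'
    have := Finset.prod_univ_sum
      (fun i => Finset.powersetCard ⌊q i * (F : ℝ)⌋₊ (Finset.univ : Finset (Fin F)))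
      (fun i' A => if i' = i then h A else 1)
    simp only [Finset.prod_ite_eq', Finset.mem_univ, if_true] at this
    rw [← this, ← Finset.mul_prod_erase _ _ (Finset.mem_univ i),
      ← Finset.mul_prod_erase Finset.univ (fun i => (F.choose ⌊q i * (F : ℝ)⌋₊ : ℝ))
        (Finset.mem_univ i)]
    have herase : ∏ i' ∈ Finset.univ.erase i, ∑ A ∈ Finset.powersetCard ⌊q i' * (F : ℝ)⌋₊
        (Finset.univ : Finset (Fin F)), (if i' = i then h A else 1) =
        ∏ i' ∈ Finset.univ.erase i, (F.choose ⌊q i' * (F : ℝ)⌋₊ : ℝ) := by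
      refine Finset.prod_congr rfl fun i' hi' => ?_
      simp [Finset.ne_of_mem_erase hi']
    rw [herase, subsetMean]
    simp only [if_true]
    field_simp
  have hcard : ((placements K q F).card : ℝ) ≠ 0 :=
    Nat.cast_ne_zero.2 (placements_card_pos hq).ne'
  rw [placementExp, div_eq_iff hcard, card_placements, placements,
    Finset.sum_prod_piFinset _ fun j (c : Fin N → Finset (Fin F)) => g j (c i)]
  simp only [hone]
  rw [Finset.prod_mul_distrib]
  simp [mul_comm]

theorem card_exactBits_eq_sum (C : Caches K N F) (i : Fin N) (T : Finset (Fin K)) :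
    ((C.exactBits i T).card : ℝ) = ∑ b, ∏ j, memIndicator (j ∈ T) b (C j i) := by
  simp only [memIndicator, Finset.prod_boole, Finset.mem_univ, true_imp_iff]
  rw [Finset.sum_boole]
  rfl

/-- Probability that a bit is cached by exactly the users in `T`. -/
noncomputable def exactProb (K F m : ℕ) (T : Finset (Fin K)) : ℝ :=
  ∏ j, if j ∈ T then (m : ℝ) / F else 1 - m / F

/-- Probability that two given bits are both cached by exactly the users in `T`. -/
noncomputable def exactPairProb (K F m : ℕ) (T : Finset (Fin K)) : ℝ :=
  ∏ j, if j ∈ T then 1 - 2 * (1 - (m : ℝ) / F) + avoidPair F m else avoidPair F m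

theorem placementExp_card_exactBits (hq : ∀ i, q i ≤ 1) (i : Fin N) (T : Finset (Fin K)) :
    placementExp K q F (fun C => ((C.exactBits i T).card : ℝ)) =
      F * exactProb K F ⌊q i * (F : ℝ)⌋₊ T := by
  have hm : ⌊q i * (F : ℝ)⌋₊ ≤ F :=
    Nat.floor_le_of_le (mul_le_of_le_one_left (Nat.cast_nonneg F) (hq i))
  simp only [card_exactBits_eq_sum]
  rw [placementExp_sum]
  have : ∀ b : Fin F, placementExp K q F (fun C => ∏ j, memIndicator (j ∈ T) b (C j i)) =
      exactProb K F ⌊q i * (F : ℝ)⌋₊ T := by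
    intro b
    rw [placementExp_prod hq i fun j => memIndicator (j ∈ T) b]
    exact Finset.prod_congr rfl fun j _ => subsetMean_memIndicator hm _ b
  simp [this]

/-- The square is a sum over ordered pairs of bits: `F` diagonal ones and `F * (F - 1)` pairs of
distinct bits. -/
theorem placementExp_card_exactBits_sq (hq : ∀ i, q i ≤ 1) (i : Fin N) (T : Finset (Fin K)) :
    placementExp K q F (fun C => ((C.exactBits i T).card : ℝ) ^ 2) =
      F * exactProb K F ⌊q i * (F : ℝ)⌋₊ T
        + F * (F - 1) * exactPairProb K F ⌊q i * (F : ℝ)⌋₊ T := by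
  have hm : ⌊q i * (F : ℝ)⌋₊ ≤ F :=
    Nat.floor_le_of_le (mul_le_of_le_one_left (Nat.cast_nonneg F) (hq i))
  set α := exactProb K F ⌊q i * (F : ℝ)⌋₊ T with hα
  set β := exactPairProb K F ⌊q i * (F : ℝ)⌋₊ T with hβ
  simp only [card_exactBits_eq_sum, sq, Finset.sum_mul_sum, ← Finset.prod_mul_distrib]
  rw [placementExp_sum]
  simp only [placementExp_sum]
  have hpair : ∀ b c : Fin F, placementExp K q F (fun C =>
      ∏ j, memIndicator (j ∈ T) b (C j i) * memIndicator (j ∈ T) c (C j i)) =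
      β + if b = c then α - β else 0 := by
    intro b c
    rw [placementExp_prod hq i fun j A => memIndicator (j ∈ T) b A * memIndicator (j ∈ T) c A]
    by_cases hbc : b = c
    · subst hbc
      rw [if_pos rfl, add_sub_cancel, hα]
      refine Finset.prod_congr rfl fun j _ => ?_
      rw [← subsetMean_memIndicator hm (j ∈ T) b]
      congr 1
      funext A
      simp [memIndicator]
    · rw [if_neg hbc, add_zero, hβ]
      exact Finset.prod_congr rfl fun j _ => subsetMean_memIndicator_mul hm _ hbc
  simp only [hpair, Finset.sum_add_distrib, Finset.sum_const, Finset.card_univ,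
    Fintype.card_fin, nsmul_eq_mul, Finset.sum_ite_eq, Finset.mem_univ, if_true]
  ring

theorem placementExp_exactBits_deviation_sq (hq : ∀ i, q i ≤ 1) (i : Fin N)
    (T : Finset (Fin K)) (v : ℝ) (hF : 0 < F) :
    placementExp K q F (fun C => (((C.exactBits i T).card : ℝ) / F - v) ^ 2) =
      exactProb K F ⌊q i * (F : ℝ)⌋₊ T * (1 / F)
        + (1 - 1 / F) * exactPairProb K F ⌊q i * (F : ℝ)⌋₊ T
        - 2 * v * exactProb K F ⌊q i * (F : ℝ)⌋₊ T + v ^ 2 := by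
  have hF' : (F : ℝ) ≠ 0 := Nat.cast_ne_zero.2 hF.ne'
  have : (fun C : Caches K N F => (((C.exactBits i T).card : ℝ) / F - v) ^ 2) = fun C =>
      (1 / (F : ℝ) ^ 2) * ((C.exactBits i T).card : ℝ) ^ 2
        - (2 * v / F) * ((C.exactBits i T).card : ℝ) + v ^ 2 := by
    funext C
    field_simp
    ring
  rw [this, placementExp_add, placementExp_sub, placementExp_const_mul, placementExp_const_mul,
    placementExp_card_exactBits hq, placementExp_card_exactBits_sq hq, placementExp_const hq]
  field_simp

end Placement

/-! ### Asymptotic independence of two bits -/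

section Limits

variable {m : ℕ → ℕ} {x : ℝ}

theorem tendsto_avoidPair (hm : Tendsto (fun F : ℕ => (m F : ℝ) / F) atTop (𝓝 x)) :
    Tendsto (fun F : ℕ => avoidPair F (m F)) atTop (𝓝 ((1 - x) ^ 2)) := by
  have h0 : Tendsto (fun F : ℕ => 1 / (F : ℝ)) atTop (𝓝 0) := tendsto_one_div_atTop_nhds_zero_nat
  have h1 := hm.const_sub 1
  have := h1.mul ((h1.sub h0).div (h0.const_sub 1) (by norm_num))
  rwa [sub_zero, sub_zero, div_one, ← sq] at this

theorem tendsto_exactProb (K : ℕ) (T : Finset (Fin K))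
    (hm : Tendsto (fun F : ℕ => (m F : ℝ) / F) atTop (𝓝 x)) :
    Tendsto (fun F : ℕ => exactProb K F (m F) T) atTop
      (𝓝 (x ^ T.card * (1 - x) ^ (K - T.card))) := by
  have hlim : x ^ T.card * (1 - x) ^ (K - T.card) = ∏ j, if j ∈ T then x else 1 - x := by
    rw [Finset.prod_ite, Finset.prod_const, Finset.prod_const, Finset.filter_mem_eq_inter,
      Finset.univ_inter, Finset.filter_not, Finset.filter_mem_eq_inter, Finset.univ_inter,
      Finset.card_sdiff_of_subset (Finset.subset_univ T), Finset.card_univ, Fintype.card_fin]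
  rw [hlim]
  refine tendsto_finsetProd _ fun j _ => ?_
  split_ifs
  · exact hm
  · exact hm.const_sub 1

theorem tendsto_exactPairProb (K : ℕ) (T : Finset (Fin K))
    (hm : Tendsto (fun F : ℕ => (m F : ℝ) / F) atTop (𝓝 x)) :
    Tendsto (fun F : ℕ => exactPairProb K F (m F) T) atTop
      (𝓝 ((x ^ T.card * (1 - x) ^ (K - T.card)) ^ 2)) := by
  have hlim : (x ^ T.card * (1 - x) ^ (K - T.card)) ^ 2 =
      ∏ j, if j ∈ T then x ^ 2 else (1 - x) ^ 2 := by
    rw [Finset.prod_ite, Finset.prod_const, Finset.prod_const, Finset.filter_mem_eq_inter,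
      Finset.univ_inter, Finset.filter_not, Finset.filter_mem_eq_inter, Finset.univ_inter,
      Finset.card_sdiff_of_subset (Finset.subset_univ T), Finset.card_univ, Fintype.card_fin,
      mul_pow, ← pow_mul, ← pow_mul, ← pow_mul, ← pow_mul, mul_comm 2, mul_comm 2]
  rw [hlim]
  refine tendsto_finsetProd _ fun j _ => ?_
  split_ifs
  -- The limit is `1 - 2 * (1 - x) + (1 - x)^2 = x^2`.
  · have := (((hm.const_sub 1).const_mul 2).const_sub 1).add (tendsto_avoidPair hm)
    convert this using 2
    ring
  · exact tendsto_avoidPair hm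

end Limits

/-! ### Concentration of the class sizes and of the rate -/

section Concentration

variable {N : ℕ} {q : Fin N → ℝ} {x : ℝ}

theorem tendsto_placementExp_abs_exactBits (K : ℕ) (hq : ∀ i, q i = x) (hx0 : 0 ≤ x)
    (hx1 : x ≤ 1) (i : Fin N) (T : Finset (Fin K)) :
    Tendsto (fun F : ℕ => placementExp K q F fun C =>
      |((C.exactBits i T).card : ℝ) / F - x ^ T.card * (1 - x) ^ (K - T.card)|) atTop (𝓝 0) := by
  set v := x ^ T.card * (1 - x) ^ (K - T.card) with hv
  have hq1 : ∀ i, q i ≤ 1 := fun i => (hq i).trans_le hx1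
  have hm : Tendsto (fun F : ℕ => (⌊q i * (F : ℝ)⌋₊ : ℝ) / F) atTop (𝓝 x) := by
    rw [hq i]
    exact (tendsto_nat_floor_mul_div_atTop hx0).comp tendsto_natCast_atTop_atTop
  have h0 : Tendsto (fun F : ℕ => 1 / (F : ℝ)) atTop (𝓝 0) := tendsto_one_div_atTop_nhds_zero_nat
  have hα := tendsto_exactProb K T hm
  have hβ := tendsto_exactPairProb K T hm
  have hsq : Tendsto (fun F : ℕ => placementExp K q F fun C =>
      (((C.exactBits i T).card : ℝ) / F - v) ^ 2) atTop (𝓝 0) := by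
    have hlim := (((hα.mul h0).add ((h0.const_sub 1).mul hβ)).sub
      (hα.const_mul (2 * v))).add_const (v ^ 2)
    rw [← hv] at hlim
    -- The mean square error vanishes because the pair probability tends to the square of the limit
    -- `v` of the single-bit probability.
    have hz : v * 0 + (1 - 0) * v ^ 2 - 2 * v * v + v ^ 2 = 0 := by ring
    rw [hz] at hlim
    refine hlim.congr' ?_
    filter_upwards [eventually_gt_atTop 0] with F hF
    exact (placementExp_exactBits_deviation_sq hq1 i T v hF).symm
  have habs : Tendsto (fun F : ℕ => (placementExp K q F fun C =>
      |((C.exactBits i T).card : ℝ) / F - v|) ^ 2) atTop (𝓝 0) := by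
    -- Passage from L² to L¹ by Cauchy–Schwarz.
    refine squeeze_zero (fun F => sq_nonneg _) (fun F => ?_) hsq
    refine (placementExp_sq_le _).trans_eq ?_
    simp only [sq_abs]
  have hsqrt := habs.sqrt
  simp only [Real.sqrt_zero, Real.sqrt_sq_eq_abs] at hsqrt
  exact (tendsto_zero_iff_abs_tendsto_zero _).2 hsqrt

theorem tendsto_placementExp_deviation (K : ℕ) (hq : ∀ i, q i = x) (hx0 : 0 ≤ x)
    (hx1 : x ≤ 1) :
    Tendsto (fun F : ℕ => placementExp K q F fun C => C.deviation x / F) atTop (𝓝 0) := by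
  have hsum := tendsto_finsetSum Finset.univ fun (i : Fin N) _ =>
    tendsto_finsetSum Finset.univ fun (T : Finset (Fin K)) _ =>
      tendsto_placementExp_abs_exactBits K hq hx0 hx1 i T
  simp only [Finset.sum_const_zero] at hsum
  refine hsum.congr' ?_
  filter_upwards [eventually_gt_atTop 0] with F hF
  have hF' : (0 : ℝ) < F := Nat.cast_pos.2 hF
  simp only [← placementExp_sum, Caches.deviation, Finset.sum_div]
  congr 1
  funext C
  refine Finset.sum_congr rfl fun i _ => Finset.sum_congr rfl fun T _ => ?_
  rw [div_sub' hF'.ne', abs_div, abs_of_pos hF']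

namespace SGD

theorem tendsto_placementExp_abs_rate_sub {K : ℕ} {order : List (Finset (Fin K))}
    (horder : IsVisitingOrder order) (f : (F : ℕ) → Files N F) (hq : ∀ i, q i = x)
    (hx0 : 0 < x) (hx1 : x ≤ 1) (d : Fin K → Fin N) :
    Tendsto (fun F : ℕ => placementExp K q F fun C =>
      |rate order (f F) C d - (1 - x) / x * (1 - (1 - x) ^ K)|) atTop (𝓝 0) := by
  have hdev := (tendsto_placementExp_deviation K hq hx0.le hx1).const_mul
    ((2 * (K : ℝ) + 1) * 2 ^ K)
  rw [mul_zero] at hdev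
  refine squeeze_zero' (Eventually.of_forall fun F => ?_) ?_ hdev
  · exact div_nonneg (Finset.sum_nonneg fun C _ => abs_nonneg _) (Nat.cast_nonneg _)
  · filter_upwards [eventually_gt_atTop 0] with F hF
    rw [← placementExp_const_mul]
    exact placementExp_mono fun C => abs_rate_sub_le horder (f F) C d hx0.ne' hF

theorem tendsto_placementExp_rate {K : ℕ} {order : List (Finset (Fin K))}
    (horder : IsVisitingOrder order) (f : (F : ℕ) → Files N F) (hq : ∀ i, q i = x)
    (hx0 : 0 < x) (hx1 : x ≤ 1) (d : Fin K → Fin N) :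
    Tendsto (fun F : ℕ => placementExp K q F fun C => rate order (f F) C d) atTop
      (𝓝 ((1 - x) / x * (1 - (1 - x) ^ K))) := by
  rw [tendsto_iff_dist_tendsto_zero]
  refine squeeze_zero (fun F => dist_nonneg) (fun F => ?_)
    (tendsto_placementExp_abs_rate_sub horder f hq hx0 hx1 d)
  rw [Real.dist_eq]
  have hconst := placementExp_const (K := K) (F := F) (fun i => (hq i).trans_le hx1)
    ((1 - x) / x * (1 - (1 - x) ^ K))
  -- Writing the limit as an expectation puts the distance in the form `|E[X - c]| ≤ E|X - c|`.
  nth_rewrite 1 [← hconst]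
  rw [← placementExp_sub]
  exact abs_placementExp_le _

end SGD

end Concentration

theorem theorem3 (K N : ℕ) (M : ℝ) (hM0 : 0 < M) (hMN : M ≤ N)
    (q : Fin N → ℝ) (hq : ∀ i, q i = M / N)
    (p : Fin N → ℝ) (hp0 : ∀ i, 0 ≤ p i) (hp1 : ∑ i, p i = 1)
    (order : List (Finset (Fin K))) (horder : IsVisitingOrder order)
    (f : (F : ℕ) → Files N F) :
    -- for every request, the rate converges to the lower bound in probability
    (∀ (d : Fin K → Fin N) (ε : ℝ), 0 < ε →
      Tendsto (fun F : ℕ => placementProb K q F fun C =>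
          ε ≤ |SGD.rate order (f F) C d
            - (1 - M / N) / (M / N) * (1 - (1 - M / N) ^ K)|)
        atTop (𝓝 0)) ∧
    -- for every request, the expected rate converges to the lower bound
    (∀ d : Fin K → Fin N,
      Tendsto (fun F : ℕ => placementExp K q F fun C => SGD.rate order (f F) C d)
        atTop (𝓝 ((1 - M / N) / (M / N) * (1 - (1 - M / N) ^ K)))) ∧
    -- the average rate converges to the lower bound
    Tendsto (fun F : ℕ => SGD.averageRate order q p (f F))
      atTop (𝓝 ((1 - M / N) / (M / N) * (1 - (1 - M / N) ^ K))) := by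

  have hN : (0 : ℝ) < N := hM0.trans_le hMN
  have hx0 : 0 < M / N := div_pos hM0 hN
  have hx1 : M / N ≤ 1 := (div_le_one hN).2 hMN
  refine ⟨fun d ε hε => ?_, fun d => SGD.tendsto_placementExp_rate horder f hq hx0 hx1 d, ?_⟩
  · have h := (SGD.tendsto_placementExp_abs_rate_sub horder f hq hx0 hx1 d).div_const ε
    rw [zero_div] at h
    exact squeeze_zero (fun F => placementProb_nonneg _)
      (fun F => placementProb_le (fun C => abs_nonneg _) hε) h
  · have h := tendsto_finsetSum Finset.univ fun (d : Fin K → Fin N) _ =>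
      (SGD.tendsto_placementExp_rate horder f hq hx0 hx1 d).const_mul (∏ k, p (d k))
    -- The average is a finite mixture over requests, all with the same limit, so only the total
    -- weight `(∑ i, p i)^K = 1` matters.
    have hprob : ∑ d : Fin K → Fin N, ∏ k, p (d k) = 1 := by
      have := Finset.prod_univ_sum (fun _ : Fin K => (Finset.univ : Finset (Fin N)))
        (fun _ i => p i)
      rw [Fintype.piFinset_univ] at this
      rw [← this]
      simp [hp1]
    rw [← Finset.sum_mul, hprob, one_mul] at h
    exact h
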